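/- Let $X=\mathbb{R}/\mathbb{Z}$, $I=[0,1/2]\subset X$, and $f=\chi_I-\chi_{X\setminus I}$. For irrational $\alpha\in(0,1)$ let $T_\alpha(x,m)=(x+\alpha,\,m+f(x))$ on $X\times\mathbb{Z}$, and for $x\in X$ let $V_{\alpha,x}$ be the set of integers $n\ge 1$ for which the second coordinate of $T_\alpha^n(x,0)$ is $0$ (equivalently, $\sum_{i=0}^{n-1}f(x+i\alpha)=0$). Then for every real $\delta>1/2$ there are uncountably many irrational $\alpha\in(0,1)$ such that $$\sum_{n\in V_{\alpha,x}}\frac1{n^{\delta}}<\infty\qquad\text{for every } x\in X .$$ Moreover, for every $\delta>1/2$ there are uncountably many such $\alpha$ with a continued fraction expansion of the form $$\alpha=[2a_1,b_1,2a_2,b_2,\ldots]=\cfrac{1}{2a_1+\cfrac{1}{b_1+\cfrac{1}{2a_2+\cdots}}}$$ with positive integers $a_i,b_i$, where the sequence $(b_i)$ is bounded and $$\sum_{n\ge1}\frac{q_{2n}^{1-\delta}}{A_n^{\delta}}<\infty .$$ Here $A_n=a_1+\cdots+a_n$ and $q_k$ is the denominator of the $k$-th convergent of $\alpha$ ($q_0=1$,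 $q_1=2a_1$). -/

import Mathlib

namespace BalancedTimes

noncomputable section

/-- The closed arc `I = [0, 1/2]` in the circle `X = ℝ / ℤ`. -/
def halfArc : Set UnitAddCircle :=
  (fun t : ℝ => (t : UnitAddCircle)) '' Set.Icc (0 : ℝ) (1 / 2)

open Classical in
/-- The function `f = χ_I - χ_{X \ I}`. -/
def f (x : UnitAddCircle) : ℤ := if x ∈ halfArc then 1 else -1

/-- The cylinder flow `T_α (x, n) = (x + α, n + f x)` on `X × ℤ`. -/
def cylinderFlow (α : ℝ) (z : UnitAddCircle × ℤ) : UnitAddCircle × ℤ :=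
  (z.1 + (α : UnitAddCircle), z.2 + f z.1)

/-- The set `V_{α,x}` of balanced times: the `n ≥ 1` at which the orbit of `(x, 0)` under the
cylinder flow is at level zero. -/
def balancedTimes (α : ℝ) (x : UnitAddCircle) : Set ℕ :=
  {n : ℕ | 0 < n ∧ ((cylinderFlow α)^[n] (x, 0)).2 = 0}

/-- The continued fraction `[c₁, c₂, …] = 1 / (c₁ + 1 / (c₂ + ⋯))` with partial quotients
`c₁ = c 0`, `c₂ = c 1`, … . Its `n`-th convergent is `p_n / q_n`, with `q_n` its `n`-th
denominator (so `q_0 = 1`, `q_1 = c₁`). -/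
def contFrac (c : ℕ → ℕ) : GenContFract ℝ where
  h := 0
  s := Stream'.Seq.ofStream fun n : ℕ => (⟨1, (c n : ℝ)⟩ : GenContFract.Pair ℝ)

/-- The sequence `2a₁, b₁, 2a₂, b₂, …`, where `a i` and `b i` stand for `a_{i+1}` and `b_{i+1}`. -/
def interleaved (a b : ℕ → ℕ) (n : ℕ) : ℕ :=
  if Even n then 2 * a (n / 2) else b (n / 2)

/-- `IsExample δ α`: the number `α` is of the form `[2a₁, b₁, 2a₂, b₂, …]` with positive integers
`a_i`, `b_i`, with the `b_i` bounded, and with `∑_{n ≥ 1} q_{2n}^{1-δ} / A_n^δ` convergent, where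
`A_n = a₁ + ⋯ + a_n` and `q_n` is the denominator of the `n`-th convergent of `α`. -/
def IsExample (δ α : ℝ) : Prop :=
  ∃ a b : ℕ → ℕ, (∀ i, 0 < a i) ∧ (∀ i, 0 < b i) ∧
    Filter.Tendsto (contFrac (interleaved a b)).convs Filter.atTop (nhds α) ∧
    (∃ M : ℕ, ∀ i, b i ≤ M) ∧
    Summable fun n : ℕ =>
      (contFrac (interleaved a b)).dens (2 * (n + 1)) ^ (1 - δ) /
        (∑ i ∈ Finset.range (n + 1), (a i : ℝ)) ^ δ

end

end BalancedTimes

namespace BalancedTimes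

/-! ### The step function along a rotation -/

/-! Take every b_i = 1 and let the a_i grow fast. Then each q_{2n} is odd and q_{2n+2} ≤ 2 q_{2n+1}.
Write S_t for the ergodic sum of f and q = q_{2n}. Since qα is within 1/q_{2n+1} of an integer, f(y
+ mα) and f(y + (m+q)α) differ for at most 20 times m < q_{2n+2} (`card_changes_le`). While they
agree, S moves along t, t+q, t+2q, … by a constant step, which is odd because q is, hence nonzero
(`card_changes_lt`). So below q_{2n+2} each value is taken at most 21 times in a residue class mod q
(`card_fiber_le`), and at most 21q times in all.

Let now t in [q_{2n+2}, q_{2n+4}) be a zero of S, and put Q = q_{2n+2}, r = t mod Q. Denjoy-Koksma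
gives |S_r| ≤ 6⌊t/Q⌋, so t ≥ Q(|S_r|+1)/7. Each r comes from at most 21 zeros, and each value of S_r
from at most 21 q_{2n} residues. Hence the block contributes at most a constant times q_{2n} Q^{-δ}
∑_{k<Q} (k+1)^{-1/2}, that is, of order q_{2n} Q^{1/2-δ} (`sum_one_div_rpow_le`). As δ > 1/2, this
is summable once Q is large enough compared with q_{2n}.

All this only asks the a_i to be large, so each can also be chosen to keep α off one term of a given
sequence; uncountability follows by diagonalization. -/

theorem coe_mem_halfArc_iff (y : ℝ) :
    (y : UnitAddCircle) ∈ halfArc ↔ ∃ k : ℤ, 0 ≤ y - k ∧ y - k ≤ 1 / 2 := by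
  constructor
  · rintro ⟨t, ht, hty⟩
    have h : ((y - t : ℝ) : UnitAddCircle) = 0 := by
      rw [AddCircle.coe_sub, sub_eq_zero]; exact hty.symm
    obtain ⟨k, hk⟩ := (AddCircle.coe_eq_zero_iff (1 : ℝ)).1 h
    refine ⟨k, ?_⟩
    have : y - k = t := by simp at hk; linarith
    rw [this]; exact ht
  · rintro ⟨k, hk⟩
    refine ⟨y - k, hk, ?_⟩
    have h : ((k : ℝ) : UnitAddCircle) = 0 := (AddCircle.coe_eq_zero_iff (1 : ℝ)).2 ⟨k, by simp⟩
    simp [h]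

theorem f_coe_eq_one {y : ℝ} (h : ∃ k : ℤ, 0 ≤ y - k ∧ y - k ≤ 1 / 2) :
    f (y : UnitAddCircle) = 1 := by
  rw [f, if_pos ((coe_mem_halfArc_iff y).2 h)]

theorem f_coe_eq_neg_one {y : ℝ} (h : ∃ k : ℤ, 1 / 2 < y - k ∧ y - k < 1) :
    f (y : UnitAddCircle) = -1 := by
  rw [f, if_neg]
  rw [coe_mem_halfArc_iff]
  rintro ⟨l, hl0, hl1⟩
  obtain ⟨k, hk0, hk1⟩ := h
  have h1 : (k : ℝ) < l + 1 := by linarith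
  have h2 : (l : ℝ) < k + 1 := by linarith
  have h3 : k < l + 1 := by exact_mod_cast h1
  have h4 : l < k + 1 := by exact_mod_cast h2
  have : k = l := by omega
  subst this
  linarith

theorem f_coe_cases (y : ℝ) :
    (f (y : UnitAddCircle) = 1 ∧ ∃ k : ℤ, 0 ≤ y - k ∧ y - k ≤ 1 / 2) ∨
      (f (y : UnitAddCircle) = -1 ∧ ∃ k : ℤ, 1 / 2 < y - k ∧ y - k < 1) := by
  have h0 := Int.floor_le y
  have h1 := Int.lt_floor_add_one y
  by_cases h : y - ⌊y⌋ ≤ 1 / 2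
  · have : ∃ k : ℤ, 0 ≤ y - k ∧ y - k ≤ 1 / 2 := ⟨⌊y⌋, by linarith, h⟩
    exact Or.inl ⟨f_coe_eq_one this, this⟩
  · have : ∃ k : ℤ, 1 / 2 < y - k ∧ y - k < 1 := ⟨⌊y⌋, by linarith, by linarith⟩
    exact Or.inr ⟨f_coe_eq_neg_one this, this⟩

theorem f_eq_one_or (x : UnitAddCircle) : f x = 1 ∨ f x = -1 := by
  unfold f; split_ifs <;> simp

/-- `f` changes under a translation by at most `ε` only `ε`-close to its two discontinuities. -/
theorem near_discontinuity_of_f_ne {y η ε : ℝ} (hη : |η| ≤ ε)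
    (h : f (y : UnitAddCircle) ≠ f ((y + η : ℝ) : UnitAddCircle)) :
    (∃ k : ℤ, -ε ≤ y - k ∧ y - k ≤ -ε + 2 * ε) ∨
      ∃ k : ℤ, 1 / 2 - ε ≤ y - k ∧ y - k ≤ 1 / 2 - ε + 2 * ε := by
  obtain ⟨hη1, hη2⟩ := abs_le.1 hη
  rcases f_coe_cases y with ⟨hy, k, hk0, hk1⟩ | ⟨hy, k, hk0, hk1⟩
  · by_cases h1 : y + η - k < 0
    · exact Or.inl ⟨k, by linarith, by linarith⟩
    · by_cases h2 : y + η - k ≤ 1 / 2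
      · exact absurd (hy.trans (f_coe_eq_one ⟨k, by linarith, h2⟩).symm) h
      · exact Or.inr ⟨k, by linarith, by linarith⟩
  · by_cases h1 : y + η - k ≤ 1 / 2
    · exact Or.inr ⟨k, by linarith, by linarith⟩
    · by_cases h2 : y + η - k < 1
      · exact absurd (hy.trans (f_coe_eq_neg_one ⟨k, by linarith, h2⟩).symm) h
      · refine Or.inl ⟨k + 1, ?_, ?_⟩ <;> push_cast <;> linarith

/-- A rotation that is `1/q`-close to `p/q` visits an arc of length `L` at most `q L + 3` times
during `q` consecutive steps. -/
theorem card_visits_le {α y u L : ℝ} {p : ℤ} {q : ℕ} (hq : 0 < q) (hpq : IsCoprime p (q : ℤ))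
    (hη : |q * α - p| * q ≤ 1) (c : ℕ) (s : Finset ℕ)
    (hL : 0 ≤ L)
    (hs : ∀ i ∈ s, c ≤ i ∧ i < c + q ∧ ∃ k : ℤ, u ≤ y + i * α - k ∧ y + i * α - k ≤ u + L) :
    (s.card : ℝ) ≤ q * L + 3 := by
  have hq' : (0 : ℝ) < q := by exact_mod_cast hq
  choose! hc hcq k hk0 hk1 using hs
  set η := q * α - p with hηdef
  -- Multiplied by q, the position at time i is the integer ip - k_i q plus a constant plus (i-c)η,
  -- and |(i-c)η| ≤ 1. So the integer lies in [A, A + qL + 2], which contains at most qL + 3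
  -- integers.
  set A : ℝ := q * (u - y) - c * η - 1 with hA
  have hmap : ∀ i ∈ s, (i : ℤ) * p - k i * q ∈ Finset.Icc ⌈A⌉ ⌊A + (q * L + 2)⌋ := by
    intro i hi
    have h1 : (c : ℝ) ≤ i := by exact_mod_cast hc i hi
    have h2 : (i : ℝ) ≤ c + q := by exact_mod_cast (hcq i hi).le
    have h3 : |(i - c) * η| ≤ 1 := by
      rw [abs_mul, abs_of_nonneg (by linarith)]
      calc ((i : ℝ) - c) * |η| ≤ q * |η| := by gcongr; linarith
        _ ≤ 1 := by linarith
    obtain ⟨h4, h5⟩ := abs_le.1 h3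
    have h6 := mul_le_mul_of_nonneg_left (hk0 i hi) hq'.le
    have h7 := mul_le_mul_of_nonneg_left (hk1 i hi) hq'.le
    have h8 : (q : ℝ) * (y + i * α - k i) = q * y + (i * p - k i * q) + c * η + (i - c) * η := by
      rw [hηdef]; ring
    rw [Finset.mem_Icc, Int.ceil_le, Int.le_floor]
    push_cast
    constructor <;> nlinarith
  have hinj : Set.InjOn (fun i : ℕ => (i : ℤ) * p - k i * q) s := by
    intro i hi j hj hij
    have h1 : ((i : ℤ) - j) * p = q * (k i - k j) := by
      simp only at hij; linarith
    have h2 : (q : ℤ) ∣ (i : ℤ) - j := hpq.symm.dvd_of_dvd_mul_right ⟨_, h1⟩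
    have h3 : |(i : ℤ) - j| < q := by
      have := hc i hi; have := hcq i hi; have := hc j hj; have := hcq j hj
      rw [abs_lt]; omega
    have := Int.eq_zero_of_abs_lt_dvd h2 h3
    omega
  have hcard := Finset.card_le_card_of_injOn _ hmap hinj
  rw [Int.card_Icc] at hcard
  have h1 : (s.card : ℤ) ≤ max (⌊A + (q * L + 2)⌋ + 1 - ⌈A⌉) 0 := by
    rw [← Int.toNat_eq_max]; exact_mod_cast hcard
  have h2 : (s.card : ℝ) ≤ max ((⌊A + (q * L + 2)⌋ : ℝ) + 1 - ⌈A⌉) 0 := by exact_mod_cast h1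
  refine h2.trans (max_le ?_ (by positivity))
  have := Int.floor_le (A + (q * L + 2))
  have := Int.le_ceil A
  linarith

/-! ### Ergodic sums -/

/-- The ergodic sum `∑_{i < n} f (y + i α)`. -/
noncomputable def ergodicSum (α y : ℝ) (n : ℕ) : ℤ :=
  ∑ i ∈ Finset.range n, f ((y + i * α : ℝ) : UnitAddCircle)

theorem cylinderFlow_iterate (α y : ℝ) (n : ℕ) :
    (cylinderFlow α)^[n] ((y : UnitAddCircle), 0) =
      (((y + n * α : ℝ) : UnitAddCircle), ergodicSum α y n) := by
  induction n with
  | zero => simp [ergodicSum]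
  | succ n ih =>
    rw [Function.iterate_succ_apply', ih, cylinderFlow, ergodicSum, ergodicSum,
      Finset.sum_range_succ, ← AddCircle.coe_add, Nat.cast_succ, add_one_mul, ← add_assoc]

theorem ergodicSum_add (α y : ℝ) (m n : ℕ) :
    ergodicSum α y (m + n) = ergodicSum α y m + ergodicSum α (y + m * α) n := by
  rw [ergodicSum, Finset.sum_range_add]
  congr 1
  refine Finset.sum_congr rfl fun i _ => ?_
  push_cast
  congr 2
  ring

theorem abs_ergodicSum_le (α y : ℝ) (n : ℕ) : |ergodicSum α y n| ≤ n := by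
  refine (Finset.abs_sum_le_sum_abs _ _).trans ?_
  refine (Finset.sum_le_card_nsmul _ _ 1 fun i _ => ?_).trans (by simp)
  rcases f_eq_one_or ((y + i * α : ℝ) : UnitAddCircle) with h | h <;> rw [h] <;> decide

theorem odd_ergodicSum (α y : ℝ) {n : ℕ} (hn : Odd n) : Odd (ergodicSum α y n) := by
  have h : ∀ n, (Odd (ergodicSum α y n) ↔ Odd n) := by
    intro n
    induction n with
    | zero => simp [ergodicSum]
    | succ n ih =>
      have h1 : Odd (f ((y + n * α : ℝ) : UnitAddCircle)) := by
        rcases f_eq_one_or ((y + n * α : ℝ) : UnitAddCircle) with h | h <;> rw [h] <;> decide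
      rw [ergodicSum, Finset.sum_range_succ, Int.odd_add, Nat.odd_add_one]
      rw [ergodicSum] at ih
      rw [ih]
      simp only [← Int.not_odd_iff_even, h1, not_true_eq_false, iff_false]
  exact (h n).2 hn

/-- A Denjoy-Koksma bound for `f`. -/
theorem abs_ergodicSum_denom_le {α : ℝ} {p : ℤ} {q : ℕ} (hq : 0 < q) (hpq : IsCoprime p (q : ℤ))
    (hη : |q * α - p| * q ≤ 1) (y : ℝ) : |ergodicSum α y q| ≤ 6 := by
  classical
  set g : ℕ → ℤ := fun i => f ((y + i * α : ℝ) : UnitAddCircle) with hg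
  set s := (Finset.range q).filter fun i => g i = 1 with hs
  set t := (Finset.range q).filter fun i => ¬ g i = 1 with ht
  have hst : s.card + t.card = q := by
    rw [hs, ht, Finset.card_filter_add_card_filter_not, Finset.card_range]
  have hsum : ergodicSum α y q = s.card - t.card := by
    rw [ergodicSum, ← Finset.sum_filter_add_sum_filter_not (Finset.range q) (fun i => g i = 1)]
    rw [Finset.sum_congr rfl (g := fun _ => (1 : ℤ)) (fun i hi => (Finset.mem_filter.1 hi).2),
      Finset.sum_congr (s₂ := t) rfl (g := fun _ => (-1 : ℤ)) (fun i hi =>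
        (f_eq_one_or _).resolve_left (Finset.mem_filter.1 hi).2)]
    simp [hs]
    ring
  -- Both half circles get at most q/2 + 3 visits and the two counts add up to q, so they differ by
  -- at most 6.
  have h1 : (s.card : ℝ) ≤ q * (1 / 2) + 3 := by
    refine card_visits_le (y := y) (u := 0) hq hpq hη 0 s (by norm_num) fun i hi => ?_
    rw [hs, Finset.mem_filter, Finset.mem_range] at hi
    refine ⟨Nat.zero_le _, by omega, ?_⟩
    rcases f_coe_cases (y + i * α) with ⟨_, k, hk0, hk1⟩ | ⟨h, _⟩
    · exact ⟨k, hk0, by linarith⟩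
    · exact absurd (hi.2.symm.trans h) (by norm_num)
  have h2 : (t.card : ℝ) ≤ q * (1 / 2) + 3 := by
    refine card_visits_le (y := y) (u := 1 / 2) hq hpq hη 0 t (by norm_num) fun i hi => ?_
    rw [ht, Finset.mem_filter, Finset.mem_range] at hi
    refine ⟨Nat.zero_le _, by omega, ?_⟩
    rcases f_coe_cases (y + i * α) with ⟨h, _⟩ | ⟨_, k, hk0, hk1⟩
    · exact absurd h hi.2
    · exact ⟨k, hk0.le, by linarith⟩
  have h3 : (s.card : ℝ) + t.card = q := by exact_mod_cast hst
  rw [hsum]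
  have h4 : |((s.card : ℝ) - t.card)| ≤ 6 := by rw [abs_le]; constructor <;> linarith
  exact_mod_cast h4

theorem abs_ergodicSum_add_mul_sub_le {α : ℝ} {p : ℤ} {q : ℕ} (hq : 0 < q)
    (hpq : IsCoprime p (q : ℤ)) (hη : |q * α - p| * q ≤ 1) (y : ℝ) (r j : ℕ) :
    |ergodicSum α y (r + q * j) - ergodicSum α y r| ≤ 6 * j := by
  induction j with
  | zero => simp
  | succ j ih =>
    have h1 := abs_ergodicSum_denom_le hq hpq hη (y + (r + q * j : ℕ) * α)
    rw [mul_add, mul_one, ← add_assoc, ergodicSum_add α y (r + q * j) q, add_sub_right_comm]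
    refine (abs_add_le _ _).trans ?_
    push_cast at h1 ⊢
    linarith

open Classical in
/-- The times before `n` at which a shift of the time by `q` changes the value of `f`. -/
noncomputable def changes (α y : ℝ) (q n : ℕ) : Finset ℕ :=
  (Finset.range n).filter fun m =>
    f ((y + m * α : ℝ) : UnitAddCircle) ≠ f ((y + (m + q : ℕ) * α : ℝ) : UnitAddCircle)

theorem changes_mono (α y : ℝ) (q : ℕ) : Monotone (changes α y q) := fun _ _ h =>
  Finset.filter_subset_filter _ (Finset.range_mono h)

theorem f_coe_add_int (y : ℝ) (k : ℤ) :
    f ((y + k : ℝ) : UnitAddCircle) = f (y : UnitAddCircle) := by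
  have h : ((k : ℝ) : UnitAddCircle) = 0 := (AddCircle.coe_eq_zero_iff (1 : ℝ)).2 ⟨k, by simp⟩
  rw [AddCircle.coe_add, h, add_zero]

/-- A change forces the orbit into a window of length 2ε around one of the two discontinuities. In
q' steps a window gets at most 2εq' + 3 ≤ 5 visits; two windows and two stretches of q' steps make
20. -/
theorem card_changes_le {α : ℝ} {p p' : ℤ} {q q' : ℕ} (hq' : 0 < q') (hpq' : IsCoprime p' (q' : ℤ))
    (hη : |q * α - p| * q' ≤ 1) (hη' : |q' * α - p'| * q' ≤ 1) (y : ℝ) :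
    (changes α y q (q' + q')).card ≤ 20 := by
  classical
  set ε := |q * α - p| with hε
  have hε0 : 0 ≤ ε := abs_nonneg _
  let A (u : ℝ) (c : ℕ) : Finset ℕ := (Finset.Ico c (c + q')).filter fun i =>
    ∃ k : ℤ, u ≤ y + i * α - k ∧ y + i * α - k ≤ u + 2 * ε
  have hA : ∀ u c, (A u c).card ≤ 5 := by
    intro u c
    have h := card_visits_le (y := y) (u := u) (L := 2 * ε) hq' hpq' hη' c (A u c) (by linarith)
      fun i hi => by
        rw [Finset.mem_filter, Finset.mem_Ico] at hi
        exact ⟨hi.1.1, hi.1.2, hi.2⟩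
    have h2 : ((A u c).card : ℝ) ≤ 5 := by linarith
    exact_mod_cast h2
  have hsub : changes α y q (q' + q') ⊆
      (A (-ε) 0 ∪ A (1 / 2 - ε) 0) ∪ (A (-ε) q' ∪ A (1 / 2 - ε) q') := by
    intro m hm
    rw [changes, Finset.mem_filter, Finset.mem_range] at hm
    have hne : f ((y + m * α : ℝ) : UnitAddCircle) ≠
        f ((y + m * α + (q * α - p) : ℝ) : UnitAddCircle) := by
      rw [← f_coe_add_int (y + m * α + (q * α - p)) p]
      convert hm.2 using 3
      push_cast
      ring
    have h := near_discontinuity_of_f_ne (ε := ε) le_rfl hne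
    simp only [A, Finset.mem_union, Finset.mem_filter, Finset.mem_Ico, zero_add, Nat.zero_le,
      true_and]
    rcases lt_or_ge m q' with h1 | h1
    · exact Or.inl (h.imp (fun h => ⟨h1, h⟩) fun h => ⟨h1, h⟩)
    · exact Or.inr (h.imp (fun h => ⟨⟨h1, hm.1⟩, h⟩) fun h => ⟨⟨h1, hm.1⟩, h⟩)
  have h1 := Finset.card_le_card hsub
  have h2 := Finset.card_union_le (A (-ε) 0 ∪ A (1 / 2 - ε) 0) (A (-ε) q' ∪ A (1 / 2 - ε) q')
  have h3 := Finset.card_union_le (A (-ε) 0) (A (1 / 2 - ε) 0)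
  have h4 := Finset.card_union_le (A (-ε) q') (A (1 / 2 - ε) q')
  have := hA (-ε) 0
  have := hA (1 / 2 - ε) 0
  have := hA (-ε) q'
  have := hA (1 / 2 - ε) q'
  omega

/-- If no shift by the odd number `q` changes `f` from time `t` on, the ergodic sum is strictly
monotone along the progression `t, t + q, …`, so that it takes no value twice. -/
theorem card_changes_lt {α y : ℝ} {q : ℕ} (hq : Odd q) {t t' : ℕ} (htt : t < t')
    (hmod : t % q = t' % q) (hS : ergodicSum α y t = ergodicSum α y t') :
    (changes α y q t).card < (changes α y q t').card := by
  by_contra hcon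
  have heq : changes α y q t = changes α y q t' :=
    Finset.eq_of_subset_of_card_le (changes_mono α y q htt.le) (not_lt.1 hcon)
  have hper : ∀ m, t ≤ m → m < t' →
      f ((y + m * α : ℝ) : UnitAddCircle) = f ((y + (m + q : ℕ) * α : ℝ) : UnitAddCircle) := by
    intro m h1 h2
    by_contra h
    have : m ∈ changes α y q t' := Finset.mem_filter.2 ⟨Finset.mem_range.2 h2, h⟩
    rw [← heq, changes, Finset.mem_filter, Finset.mem_range] at this
    omega
  obtain ⟨j, hj⟩ : q ∣ t' - t := (Nat.modEq_iff_dvd' htt.le).1 hmod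
  -- Without changes all blocks of length q from t to t' have the same sum, so returning to the same
  -- value needs j = 0 or a zero block sum; the latter is odd.
  have hblock : ∀ l < j, ergodicSum α (y + (t + q * l : ℕ) * α) q =
      ergodicSum α (y + t * α) q := by
    intro l
    induction l with
    | zero => simp
    | succ l ih =>
      intro hl
      rw [← ih (by omega)]
      refine Finset.sum_congr rfl fun i hi => ?_
      rw [Finset.mem_range] at hi
      have hlt : t + q * l + i < t' := by
        have : q * (l + 1) ≤ q * j := Nat.mul_le_mul_left q hl.le
        rw [mul_add] at this
        omega
      have := hper (t + q * l + i) (by omega) hlt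
      convert this.symm using 3 <;> push_cast <;> ring
  have hsum : ∀ l ≤ j, ergodicSum α y (t + q * l) =
      ergodicSum α y t + l * ergodicSum α (y + t * α) q := by
    intro l
    induction l with
    | zero => simp
    | succ l ih =>
      intro hl
      rw [mul_add, mul_one, ← add_assoc, ergodicSum_add, ih (by omega), hblock l (by omega)]
      push_cast
      ring
  have h1 := hsum j le_rfl
  rw [← hj, show t + (t' - t) = t' by omega, ← hS] at h1
  have h2 : (j : ℤ) * ergodicSum α (y + t * α) q = 0 := by linarith
  rcases mul_eq_zero.1 h2 with h3 | h3
  · have : j = 0 := by exact_mod_cast h3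
    subst this
    omega
  · have := odd_ergodicSum α (y + t * α) hq
    rw [h3] at this
    exact absurd this (by decide)

/-! ### Counting the times at which an ergodic sum takes a given value -/

/-- The number of changes before t is injective on `s` by `card_changes_lt`, and it lies between 0
and 20. -/
theorem card_fiber_le {α y : ℝ} {q N : ℕ} (hq : Odd q) (hch : (changes α y q N).card ≤ 20)
    (s : Finset ℕ) (r : ℕ) (v : ℤ)
    (hs : ∀ t ∈ s, t < N ∧ t % q = r ∧ ergodicSum α y t = v) : s.card ≤ 21 := by
  rw [← Finset.card_range 21]
  refine Finset.card_le_card_of_injOn (fun t => (changes α y q t).card) (fun t ht => ?_) ?_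
  · have := Finset.card_le_card (changes_mono α y q (hs t ht).1.le)
    exact Finset.mem_coe.2 (Finset.mem_range.2 (Nat.lt_succ_of_le (this.trans hch)))
  · intro t ht t' ht' htt
    obtain ⟨-, h1, h2⟩ := hs t ht
    obtain ⟨-, h1', h2'⟩ := hs t' ht'
    simp only at htt
    rcases lt_trichotomy t t' with h | h | h
    · have := card_changes_lt hq h (h1.trans h1'.symm) (h2.trans h2'.symm)
      omega
    · exact h
    · have := card_changes_lt hq h (h1'.trans h1.symm) (h2'.trans h2.symm)
      omega

theorem card_level_le {α y : ℝ} {q N : ℕ} (hq : Odd q) (hch : (changes α y q N).card ≤ 20)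
    (s : Finset ℕ) (v : ℤ) (hs : ∀ t ∈ s, t < N ∧ ergodicSum α y t = v) : s.card ≤ 21 * q := by
  have h := Finset.card_le_mul_card_image_of_maps_to (s := s) (t := Finset.range q)
    (f := fun t => t % q) (fun t _ => Finset.mem_range.2 (Nat.mod_lt _ hq.pos)) 21 fun r _ =>
      card_fiber_le (α := α) (y := y) hq hch _ r v fun t ht => by
        rw [Finset.mem_filter] at ht
        exact ⟨(hs t ht.1).1, ht.2, (hs t ht.1).2⟩
  rwa [Finset.card_range] at h

theorem sum_comp_le {ι κ : Type*} [DecidableEq κ] {s : Finset ι} {t : Finset κ} {φ : ι → κ}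
    {g : κ → ℝ} {c : ℕ} (hφ : ∀ a ∈ s, φ a ∈ t) (hg : ∀ b ∈ t, 0 ≤ g b)
    (hc : ∀ b ∈ t, (s.filter fun a => φ a = b).card ≤ c) :
    ∑ a ∈ s, g (φ a) ≤ c * ∑ b ∈ t, g b := by
  rw [← Finset.sum_fiberwise_of_maps_to hφ, Finset.mul_sum]
  refine Finset.sum_le_sum fun b hb => ?_
  rw [Finset.sum_congr rfl (g := fun _ => g b) fun a ha => by rw [(Finset.mem_filter.1 ha).2],
    Finset.sum_const, nsmul_eq_mul]
  exact mul_le_mul_of_nonneg_right (by exact_mod_cast hc b hb) (hg b hb)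

theorem sum_one_div_sqrt_le (n : ℕ) :
    ∑ k ∈ Finset.range n, 1 / √((k : ℝ) + 1) ≤ 2 * √(n : ℝ) := by
  induction n with
  | zero => simp
  | succ n ih =>
    rw [Finset.sum_range_succ]
    have h0 : 0 < √((n : ℝ) + 1) := Real.sqrt_pos.2 (by positivity)
    have h1 : √(n : ℝ) * √((n : ℝ) + 1) ≤ n + 1 / 2 := by
      nlinarith [sq_nonneg (√(n : ℝ) - √((n : ℝ) + 1)), Real.sq_sqrt (x := (n : ℝ)) (by positivity),
        Real.sq_sqrt (x := (n : ℝ) + 1) (by positivity)]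
    have h2 : 1 / √((n : ℝ) + 1) ≤ 2 * √((n : ℝ) + 1) - 2 * √(n : ℝ) := by
      rw [div_le_iff₀ h0]
      nlinarith [Real.sq_sqrt (x := (n : ℝ) + 1) (by positivity)]
    push_cast
    linarith

/-- Here `S` stands for the ergodic sums, `q₀` and `q` for consecutive odd denominators, `Z` for the
balanced times of one block. The constant is 1764 = 21 · 42 · 2: times per residue, residues per |S
r| in units of `q₀` (both signs), and the bound 2√q. -/
theorem sum_one_div_rpow_le {δ : ℝ} (hδ : 1 / 2 ≤ δ) {S : ℕ → ℤ} {q₀ q : ℕ} (hq : 0 < q)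
    (hS : ∀ r, |S r| ≤ r)
    (hlev : ∀ v, ((Finset.range q).filter fun r => S r = v).card ≤ 21 * q₀)
    (Z : Finset ℕ) (hZ : ∀ t ∈ Z, q ≤ t ∧ |S (t % q)| ≤ 6 * (t / q : ℕ))
    (hfib : ∀ r, (Z.filter fun t => t % q = r).card ≤ 21) :
    ∑ t ∈ Z, 1 / (t : ℝ) ^ δ ≤ 7 ^ δ * 1764 * q₀ * (q : ℝ) ^ (1 / 2 - δ) := by
  have hqr : (0 : ℝ) < q := by exact_mod_cast hq
  let w : ℕ → ℝ := fun k => 1 / √((k : ℝ) + 1)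
  have hw : ∀ k, 0 ≤ w k := fun k => by positivity
  have hpt : ∀ t ∈ Z, 1 / (t : ℝ) ^ δ ≤ 7 ^ δ * (q : ℝ) ^ (-δ) * w (S (t % q)).natAbs := by
    intro t ht
    obtain ⟨h1, h2⟩ := hZ t ht
    set k := (S (t % q)).natAbs with hk
    have h3 : k ≤ 6 * (t / q) := by
      rw [Int.abs_eq_natAbs] at h2; exact_mod_cast h2
    have h4 : 1 ≤ t / q := (Nat.one_le_div_iff hq).2 h1
    -- As t/q ≥ 1, k + 1 ≤ 6(t/q) + 1 ≤ 7(t/q).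
    have h5 : q * (k + 1) ≤ 7 * t := by
      calc q * (k + 1) ≤ q * (7 * (t / q)) := Nat.mul_le_mul_left q (by omega)
        _ = 7 * (q * (t / q)) := by ring
        _ ≤ 7 * t := Nat.mul_le_mul_left 7 (Nat.mul_div_le t q)
    have h6 : (q : ℝ) * (k + 1) ≤ 7 * t := by exact_mod_cast h5
    have ht0 : (0 : ℝ) < t := by exact_mod_cast hq.trans_le h1
    have hk0 : (0 : ℝ) < (k : ℝ) + 1 := by positivity
    -- Lowering the exponent of k + 1 from δ to 1/2 costs nothing essential and avoids separate
    -- cases for the sum over k.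
    have h7 : (q : ℝ) ^ δ * √((k : ℝ) + 1) ≤ 7 ^ δ * (t : ℝ) ^ δ := by
      rw [← Real.mul_rpow (by norm_num) ht0.le]
      calc (q : ℝ) ^ δ * √((k : ℝ) + 1) ≤ (q : ℝ) ^ δ * ((k : ℝ) + 1) ^ δ := by
            rw [Real.sqrt_eq_rpow]
            gcongr
            linarith [(Nat.cast_nonneg k : (0 : ℝ) ≤ k)]
        _ = ((q : ℝ) * (k + 1)) ^ δ := (Real.mul_rpow hqr.le hk0.le).symm
        _ ≤ (7 * (t : ℝ)) ^ δ := Real.rpow_le_rpow (by positivity) h6 (by linarith)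
    have h8 : 0 < √((k : ℝ) + 1) := Real.sqrt_pos.2 hk0
    have h9 : (0 : ℝ) < (q : ℝ) ^ δ := by positivity
    have h10 : (0 : ℝ) < (t : ℝ) ^ δ := by positivity
    have h11 : (7 : ℝ) ^ δ * (q : ℝ) ^ (-δ) * w k = 7 ^ δ / ((q : ℝ) ^ δ * √((k : ℝ) + 1)) := by
      simp only [w]
      rw [Real.rpow_neg hqr.le]
      field_simp
    rw [h11, div_le_div_iff₀ h10 (by positivity)]
    linarith
  have hsum1 : ∑ t ∈ Z, w (S (t % q)).natAbs ≤
      (21 : ℕ) * ∑ r ∈ Finset.range q, w (S r).natAbs :=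
    sum_comp_le (φ := fun t => t % q) (g := fun r => w (S r).natAbs)
      (fun t _ => Finset.mem_range.2 (Nat.mod_lt _ hq)) (fun r _ => hw _) fun r _ => hfib r
  have hsum2 : ∑ r ∈ Finset.range q, w (S r).natAbs ≤
      (42 * q₀ : ℕ) * ∑ k ∈ Finset.range q, w k := by
    refine sum_comp_le (φ := fun r => (S r).natAbs) (g := w) (fun r hr => ?_) (fun _ _ => hw _)
      fun k _ => ?_
    · have := hS r
      rw [Int.abs_eq_natAbs] at this
      rw [Finset.mem_range] at hr ⊢
      omega
    · have hsub : ((Finset.range q).filter fun r => (S r).natAbs = k) ⊆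
          ((Finset.range q).filter fun r => S r = k) ∪
            (Finset.range q).filter fun r => S r = -k := by
        intro r hr
        simp only [Finset.mem_union, Finset.mem_filter] at hr ⊢
        have := Int.natAbs_eq_iff.1 hr.2
        exact this.imp (fun h => ⟨hr.1, h⟩) fun h => ⟨hr.1, h⟩
      have h1 := (Finset.card_le_card hsub).trans (Finset.card_union_le _ _)
      have := hlev k
      have := hlev (-k)
      omega
  have hsum3 := sum_one_div_sqrt_le q
  calc ∑ t ∈ Z, 1 / (t : ℝ) ^ δ ≤ ∑ t ∈ Z, 7 ^ δ * (q : ℝ) ^ (-δ) * w (S (t % q)).natAbs :=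
        Finset.sum_le_sum hpt
    _ = 7 ^ δ * (q : ℝ) ^ (-δ) * ∑ t ∈ Z, w (S (t % q)).natAbs := by rw [Finset.mul_sum]
    _ ≤ 7 ^ δ * (q : ℝ) ^ (-δ) * ((21 : ℕ) * ((42 * q₀ : ℕ) * (2 * √(q : ℝ)))) := by
        gcongr
        refine hsum1.trans ?_
        gcongr
        refine hsum2.trans ?_
        gcongr
    _ = 7 ^ δ * 1764 * q₀ * (q : ℝ) ^ (1 / 2 - δ) := by
        rw [sub_eq_add_neg, Real.rpow_add hqr, Real.sqrt_eq_rpow]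
        push_cast
        ring

/-! ### Convergents -/

/-- The numerators of the convergents of `[c₁, c₂, …]`. -/
def cfNum (c : ℕ → ℕ) : ℕ → ℕ
  | 0 => 0
  | 1 => 1
  | n + 2 => c (n + 1) * cfNum c (n + 1) + cfNum c n

/-- The denominators of the convergents of `[c₁, c₂, …]`. -/
def cfDen (c : ℕ → ℕ) : ℕ → ℕ
  | 0 => 1
  | 1 => c 0
  | n + 2 => c (n + 1) * cfDen c (n + 1) + cfDen c n

theorem contFrac_s_get? (c : ℕ → ℕ) (n : ℕ) :
    (contFrac c).s.get? n = some ⟨1, (c n : ℝ)⟩ := rfl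

theorem contFrac_nums_dens (c : ℕ → ℕ) (n : ℕ) :
    (contFrac c).nums n = cfNum c n ∧ (contFrac c).dens n = cfDen c n ∧
      (contFrac c).nums (n + 1) = cfNum c (n + 1) ∧
      (contFrac c).dens (n + 1) = cfDen c (n + 1) := by
  induction n with
  | zero =>
    refine ⟨?_, ?_, ?_, ?_⟩
    · simp [GenContFract.zeroth_num_eq_h, cfNum, contFrac]
    · simp [cfDen]
    · rw [GenContFract.first_num_eq (contFrac_s_get? c 0)]
      simp [cfNum, contFrac]
    · rw [GenContFract.first_den_eq (contFrac_s_get? c 0)]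
      simp [cfDen]
  | succ n ih =>
    obtain ⟨h1, h2, h3, h4⟩ := ih
    refine ⟨h3, h4, ?_, ?_⟩
    · rw [GenContFract.nums_recurrence (contFrac_s_get? c (n + 1)) h1 h3]
      simp [cfNum]
    · rw [GenContFract.dens_recurrence (contFrac_s_get? c (n + 1)) h2 h4]
      simp [cfDen]

theorem contFrac_dens (c : ℕ → ℕ) (n : ℕ) : (contFrac c).dens n = cfDen c n :=
  (contFrac_nums_dens c n).2.1

theorem contFrac_convs (c : ℕ → ℕ) (n : ℕ) :
    (contFrac c).convs n = (cfNum c n : ℝ) / cfDen c n := by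
  rw [GenContFract.conv_eq_num_div_den, (contFrac_nums_dens c n).1, contFrac_dens]

theorem cfDen_pos {c : ℕ → ℕ} (hc : ∀ n, 0 < c n) (n : ℕ) : 0 < cfDen c n ∧ 0 < cfDen c (n + 1) := by
  induction n with
  | zero => exact ⟨one_pos, hc 0⟩
  | succ n ih => exact ⟨ih.2, Nat.add_pos_right _ ih.1⟩

theorem cfDen_mono {c : ℕ → ℕ} (hc : ∀ n, 0 < c n) : Monotone (cfDen c) := by
  refine monotone_nat_of_le_succ fun n => ?_
  cases n with
  | zero => exact hc 0
  | succ n =>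
    exact (Nat.le_mul_of_pos_left _ (hc (n + 1))).trans (Nat.le_add_right _ _)

theorem cfDen_add_le {c : ℕ → ℕ} (hc : ∀ n, 0 < c n) (n : ℕ) :
    cfDen c (n + 1) + cfDen c n ≤ cfDen c (n + 2) :=
  Nat.add_le_add_right (Nat.le_mul_of_pos_left _ (hc (n + 1))) _

theorem cf_determinant (c : ℕ → ℕ) (n : ℕ) :
    (cfDen c n : ℤ) * cfNum c (n + 1) - cfNum c n * cfDen c (n + 1) = (-1) ^ n := by
  induction n with
  | zero => simp [cfNum, cfDen]
  | succ n ih =>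
    rw [pow_succ, ← ih]
    simp only [cfNum, cfDen]
    push_cast
    ring

theorem isCoprime_cf (c : ℕ → ℕ) (n : ℕ) : IsCoprime (cfNum c n : ℤ) (cfDen c n : ℤ) := by
  have h := cf_determinant c n
  have h2 : ((-1 : ℤ) ^ n) * (-1) ^ n = 1 := by rw [← mul_pow]; simp
  refine ⟨-(-1) ^ n * cfDen c (n + 1), (-1) ^ n * cfNum c (n + 1), ?_⟩
  linear_combination (-1) ^ n * h + h2

/-- As a function of the second index, the cross term obeys the recurrence of the denominators,
starting from 0 and ±1. -/
theorem abs_cf_cross_le {c : ℕ → ℕ} (n m : ℕ) :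
    |(cfDen c n : ℤ) * cfNum c (n + m) - cfNum c n * cfDen c (n + m)| * cfDen c (n + 1) ≤
        cfDen c (n + m) ∧
      |(cfDen c n : ℤ) * cfNum c (n + (m + 1)) - cfNum c n * cfDen c (n + (m + 1))| *
          cfDen c (n + 1) ≤ cfDen c (n + (m + 1)) := by
  induction m with
  | zero =>
    constructor
    · simp [mul_comm]
    · rw [zero_add, cf_determinant]
      simp
  | succ m ih =>
    refine ⟨ih.2, ?_⟩
    set E := fun k => (cfDen c n : ℤ) * cfNum c k - cfNum c n * cfDen c k with hE
    have hrec : E (n + m + 2) = c (n + m + 1) * E (n + m + 1) + E (n + m) := by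
      simp only [hE, cfNum, cfDen]
      push_cast
      ring
    have h1 : |E (n + m)| * cfDen c (n + 1) ≤ cfDen c (n + m) := ih.1
    have h2 : |E (n + m + 1)| * cfDen c (n + 1) ≤ cfDen c (n + m + 1) := ih.2
    change |E (n + m + 2)| * cfDen c (n + 1) ≤ cfDen c (n + m + 2)
    rw [hrec, cfDen]
    have h3 : |c (n + m + 1) * E (n + m + 1) + E (n + m)| ≤
        c (n + m + 1) * |E (n + m + 1)| + |E (n + m)| := by
      refine (abs_add_le _ _).trans ?_
      rw [abs_mul, Nat.abs_cast]
    push_cast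
    calc _ ≤ (c (n + m + 1) * |E (n + m + 1)| + |E (n + m)|) * (cfDen c (n + 1) : ℤ) := by
          gcongr
      _ = c (n + m + 1) * (|E (n + m + 1)| * cfDen c (n + 1)) + |E (n + m)| * cfDen c (n + 1) := by
          ring
      _ ≤ _ := by gcongr

theorem abs_den_mul_conv_sub_le {c : ℕ → ℕ} (hc : ∀ n, 0 < c n) {n m : ℕ} (hnm : n ≤ m) :
    |cfDen c n * ((cfNum c m : ℝ) / cfDen c m) - cfNum c n| ≤ 1 / cfDen c (n + 1) := by
  obtain ⟨k, rfl⟩ := Nat.exists_eq_add_of_le hnm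
  have h : |(cfDen c n : ℝ) * cfNum c (n + k) - cfNum c n * cfDen c (n + k)| * cfDen c (n + 1) ≤
      cfDen c (n + k) := by exact_mod_cast (abs_cf_cross_le (c := c) n k).1
  have h1 : (0 : ℝ) < cfDen c (n + 1) := by exact_mod_cast (cfDen_pos hc n).2
  have h2 : (0 : ℝ) < cfDen c (n + k) := by exact_mod_cast (cfDen_pos hc (n + k)).1
  have h3 : (cfDen c n : ℝ) * (cfNum c (n + k) / cfDen c (n + k)) - cfNum c n =
      (cfDen c n * cfNum c (n + k) - cfNum c n * cfDen c (n + k)) / cfDen c (n + k) := by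
    field_simp
  rw [h3, abs_div, abs_of_pos h2, div_le_div_iff₀ h2 h1]
  linarith

theorem self_le_cfDen {c : ℕ → ℕ} (hc : ∀ n, 0 < c n) (n : ℕ) : n ≤ cfDen c n := by
  have h : ∀ n, n ≤ cfDen c n ∧ n + 1 ≤ cfDen c (n + 1) := by
    intro n
    induction n with
    | zero => exact ⟨Nat.zero_le _, hc 0⟩
    | succ n ih =>
      have : cfDen c (n + 1) + cfDen c n ≤ cfDen c (n + 1 + 1) := cfDen_add_le hc n
      have := (cfDen_pos hc n).1
      exact ⟨ih.2, by omega⟩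
  exact (h n).1

/-- The value of an infinite continued fraction and the quality of its convergents. -/
theorem exists_contFrac_limit {c : ℕ → ℕ} (hc : ∀ n, 0 < c n) :
    ∃ α : ℝ, Filter.Tendsto (contFrac c).convs Filter.atTop (nhds α) ∧
      ∀ n, |cfDen c n * α - cfNum c n| ≤ 1 / cfDen c (n + 1) := by
  have hcau : CauchySeq (fun n => (cfNum c n : ℝ) / cfDen c n) := by
    refine cauchySeq_of_le_tendsto_0' (fun n => 1 / ((n : ℝ) + 1)) (fun n m hnm => ?_)
      tendsto_one_div_add_atTop_nhds_zero_nat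
    have h := abs_den_mul_conv_sub_le hc hnm
    have h0 : (1 : ℝ) ≤ cfDen c n := by exact_mod_cast (cfDen_pos hc n).1
    have h2 : (n : ℝ) + 1 ≤ cfDen c (n + 1) := by exact_mod_cast self_le_cfDen hc (n + 1)
    have h3 : (cfNum c m : ℝ) / cfDen c m - cfNum c n / cfDen c n =
        (cfDen c n * ((cfNum c m : ℝ) / cfDen c m) - cfNum c n) / cfDen c n := by
      field_simp
    rw [dist_comm, Real.dist_eq, h3, abs_div, abs_of_pos (by linarith : (0 : ℝ) < cfDen c n)]
    calc _ ≤ _ := div_le_self (abs_nonneg _) h0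
      _ ≤ _ := h
      _ ≤ 1 / ((n : ℝ) + 1) := one_div_le_one_div_of_le (by positivity) h2
  obtain ⟨α, hα⟩ := cauchySeq_tendsto_of_complete hcau
  refine ⟨α, hα.congr fun n => (contFrac_convs c n).symm, fun n => ?_⟩
  have hlim : Filter.Tendsto (fun m => |cfDen c n * ((cfNum c m : ℝ) / cfDen c m) - cfNum c n|)
      Filter.atTop (nhds |cfDen c n * α - cfNum c n|) :=
    ((hα.const_mul _).sub_const _).abs
  exact le_of_tendsto hlim (Filter.eventually_atTop.2 ⟨n, fun m hm => abs_den_mul_conv_sub_le hc hm⟩)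

/-- Otherwise the determinant identity gives q_n |q_{n+1}α - p_{n+1}| = 1, against the bound
q_n/q_{n+2} < 1. The diagonal argument uses this before α is known to be irrational. -/
theorem den_mul_sub_num_ne_zero {c : ℕ → ℕ} (hc : ∀ n, 0 < c n) {α : ℝ}
    (hα : ∀ n, |cfDen c n * α - cfNum c n| ≤ 1 / cfDen c (n + 1)) (n : ℕ) :
    (cfDen c n : ℝ) * α - cfNum c n ≠ 0 := by
  intro h
  have h0 : (0 : ℝ) < cfDen c n := by exact_mod_cast (cfDen_pos hc n).1
  have h1 : (cfDen c n : ℝ) < cfDen c (n + 2) := by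
    have := cfDen_add_le hc n
    have := (cfDen_pos hc n).2
    exact_mod_cast (by omega : cfDen c n < cfDen c (n + 2))
  have hdet : (cfDen c n : ℝ) * cfNum c (n + 1) - cfNum c n * cfDen c (n + 1) = (-1) ^ n := by
    exact_mod_cast cf_determinant c n
  have h2 : cfDen c n * (cfDen c (n + 1) * α - cfNum c (n + 1)) = -(-1) ^ n := by
    rw [← hdet]; linear_combination (cfDen c (n + 1) : ℝ) * h
  have h3 : cfDen c n * |cfDen c (n + 1) * α - cfNum c (n + 1)| = 1 := by
    have h4 := congrArg abs h2
    rwa [abs_mul, abs_of_pos h0, abs_neg, abs_pow, abs_neg, abs_one, one_pow] at h4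
  have h4 := hα (n + 1)
  rw [le_div_iff₀ (h0.trans h1)] at h4
  have h5 : 0 < |cfDen c (n + 1) * α - cfNum c (n + 1)| := by
    by_contra h6
    nlinarith [abs_nonneg ((cfDen c (n + 1) : ℝ) * α - cfNum c (n + 1))]
  nlinarith

/-! ### Summability over the balanced times -/

theorem abs_den_mul_sub_num_mul_le {c : ℕ → ℕ} (hc : ∀ n, 0 < c n) {α : ℝ}
    (hα : ∀ n, |cfDen c n * α - cfNum c n| ≤ 1 / cfDen c (n + 1)) {m n : ℕ} (hmn : m ≤ n + 1) :
    |cfDen c n * α - (cfNum c n : ℤ)| * cfDen c m ≤ 1 := by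
  have h1 : (0 : ℝ) < cfDen c (n + 1) := by exact_mod_cast (cfDen_pos hc n).2
  have h2 : (cfDen c m : ℝ) ≤ cfDen c (n + 1) := by exact_mod_cast cfDen_mono hc hmn
  have h3 := hα n
  rw [le_div_iff₀ h1] at h3
  rw [Int.cast_natCast]
  exact (mul_le_mul_of_nonneg_left h2 (abs_nonneg _)).trans h3

/-- The partial quotient 1 gives q_{n+2} ≤ 2q_{n+1}, so the two stretches of `card_changes_le` cover
all times below q_{n+2}. -/
theorem card_changes_cfDen_le {c : ℕ → ℕ} (hc : ∀ n, 0 < c n) {α : ℝ}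
    (hα : ∀ n, |cfDen c n * α - cfNum c n| ≤ 1 / cfDen c (n + 1)) {n : ℕ} (hn : c (n + 1) = 1)
    (y : ℝ) : (changes α y (cfDen c n) (cfDen c (n + 2))).card ≤ 20 := by
  have hle : cfDen c (n + 2) ≤ cfDen c (n + 1) + cfDen c (n + 1) := by
    rw [cfDen, hn, one_mul]
    exact Nat.add_le_add_left (cfDen_mono hc (Nat.le_succ n)) _
  exact (Finset.card_le_card (changes_mono α y _ hle)).trans
    (card_changes_le (cfDen_pos hc n).2 (isCoprime_cf c (n + 1))
      (abs_den_mul_sub_num_mul_le hc hα le_rfl)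
      (abs_den_mul_sub_num_mul_le hc hα (Nat.le_succ _)) y)

theorem sum_balanced_block_le {δ : ℝ} (hδ : 1 / 2 ≤ δ) {c : ℕ → ℕ} (hc : ∀ n, 0 < c n) {α : ℝ}
    (hα : ∀ n, |cfDen c n * α - cfNum c n| ≤ 1 / cfDen c (n + 1))
    (hodd : ∀ n, Odd (cfDen c (2 * n))) (hb : ∀ n, c (2 * n + 1) = 1) (y : ℝ) (n : ℕ) :
    ∑ t ∈ (Finset.Ico (cfDen c (2 * n + 2)) (cfDen c (2 * n + 4))).filter
        (fun t => ergodicSum α y t = 0), 1 / (t : ℝ) ^ δ ≤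
      7 ^ δ * 1764 * cfDen c (2 * n) * (cfDen c (2 * n + 2) : ℝ) ^ (1 / 2 - δ) := by
  have hq := (cfDen_pos hc (2 * n + 2)).1
  refine sum_one_div_rpow_le hδ hq (abs_ergodicSum_le α y) (fun v => ?_) _ (fun t ht => ?_)
    fun r => ?_
  · refine card_level_le (hodd n) (card_changes_cfDen_le hc hα (hb n) y) _ v fun t ht => ?_
    rwa [Finset.mem_filter, Finset.mem_range] at ht
  · rw [Finset.mem_filter, Finset.mem_Ico] at ht
    refine ⟨ht.1.1, ?_⟩
    have h := abs_ergodicSum_add_mul_sub_le hq (isCoprime_cf c (2 * n + 2))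
      (abs_den_mul_sub_num_mul_le hc hα (Nat.le_succ _)) y (t % cfDen c (2 * n + 2))
      (t / cfDen c (2 * n + 2))
    rwa [Nat.mod_add_div, ht.2, zero_sub, abs_neg] at h
  · refine card_fiber_le (hodd (n + 1)) (card_changes_cfDen_le hc hα (hb (n + 1)) y) _ r 0
      fun t ht => ?_
    rw [Finset.mem_filter, Finset.mem_filter, Finset.mem_Ico] at ht
    exact ⟨ht.1.1.2, ht.2, ht.1.2⟩

theorem summable_balancedTimes {δ : ℝ} (hδ : 1 / 2 ≤ δ) {c : ℕ → ℕ} (hc : ∀ n, 0 < c n) {α : ℝ}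
    (hα : ∀ n, |cfDen c n * α - cfNum c n| ≤ 1 / cfDen c (n + 1))
    (hodd : ∀ n, Odd (cfDen c (2 * n))) (hb : ∀ n, c (2 * n + 1) = 1)
    (hgrowth : ∀ n, cfDen c (2 * n) * (cfDen c (2 * n + 2) : ℝ) ^ (1 / 2 - δ) ≤ (1 / 2) ^ n)
    (x : UnitAddCircle) :
    Summable fun n : balancedTimes α x => 1 / ((n : ℕ) : ℝ) ^ δ := by
  obtain ⟨y, rfl⟩ := QuotientAddGroup.mk_surjective x
  change Summable ((fun n : ℕ => 1 / (n : ℝ) ^ δ) ∘ ((↑) : balancedTimes α (y : UnitAddCircle) → ℕ))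
  rw [summable_subtype_iff_indicator]
  set g := (balancedTimes α (y : UnitAddCircle)).indicator (fun n : ℕ => 1 / (n : ℝ) ^ δ) with hg
  have hg0 : ∀ n, 0 ≤ g n := fun n => Set.indicator_nonneg (fun n _ => by positivity) n
  set C : ℝ := 7 ^ δ * 1764 with hC
  have hC0 : 0 ≤ C := by positivity
  have hblock : ∀ n, ∑ t ∈ Finset.Ico (cfDen c (2 * n + 2)) (cfDen c (2 * n + 4)), g t ≤
      C * (1 / 2) ^ n := by
    intro n
    have h1 : ∑ t ∈ Finset.Ico (cfDen c (2 * n + 2)) (cfDen c (2 * n + 4)), g t =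
        ∑ t ∈ (Finset.Ico (cfDen c (2 * n + 2)) (cfDen c (2 * n + 4))).filter
          (fun t => ergodicSum α y t = 0), 1 / (t : ℝ) ^ δ := by
      rw [Finset.sum_filter]
      refine Finset.sum_congr rfl fun t ht => ?_
      have h0 : 0 < t := (cfDen_pos hc (2 * n + 2)).1.trans_le (Finset.mem_Ico.1 ht).1
      have hiff : t ∈ balancedTimes α (y : UnitAddCircle) ↔ ergodicSum α y t = 0 := by
        simp only [balancedTimes, Set.mem_ofPred_eq, cylinderFlow_iterate, h0, true_and]
      by_cases hS : ergodicSum α y t = 0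
      · rw [hg, Set.indicator_of_mem (hiff.2 hS), if_pos hS]
      · rw [hg, Set.indicator_of_notMem (mt hiff.1 hS), if_neg hS]
    rw [h1]
    refine (sum_balanced_block_le hδ hc hα hodd hb y n).trans ?_
    rw [mul_assoc]
    exact mul_le_mul_of_nonneg_left (hgrowth n) hC0
  set G : ℕ → ℝ := fun n => ∑ t ∈ Finset.range (cfDen c (2 * n + 2)), g t with hG
  -- The bracket is the partial sum of the geometric series bounding the blocks.
  have hGle : ∀ n, G n ≤ G 0 + C * (2 - 2 * (1 / 2) ^ n) := by
    intro n
    induction n with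
    | zero => simp
    | succ n ih =>
      have h1 : G (n + 1) =
          G n + ∑ t ∈ Finset.Ico (cfDen c (2 * n + 2)) (cfDen c (2 * n + 4)), g t := by
        simp only [hG]
        rw [Finset.range_eq_Ico, Finset.range_eq_Ico,
          Finset.sum_Ico_consecutive g (Nat.zero_le _) (cfDen_mono hc (by omega))]
        rfl
      have h2 := hblock n
      rw [h1, pow_succ]
      linarith
  refine summable_of_sum_range_le (c := G 0 + C * 2) hg0 fun n => ?_
  have h1 : n ≤ cfDen c (2 * n + 2) :=
    (by omega : n ≤ 2 * n + 2).trans (self_le_cfDen hc (2 * n + 2))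
  have h2 : ∑ i ∈ Finset.range n, g i ≤ G n :=
    Finset.sum_le_sum_of_subset_of_nonneg (Finset.range_mono h1) fun i _ _ => hg0 i
  have h3 : 0 ≤ C * (2 * (1 / 2) ^ n) := by positivity
  linarith [hGle n]

/-! ### Rapidly growing partial quotients -/

/-- Each `a n` may be prescribed in terms of the convergent that precedes it. -/
theorem exists_interleaved_eq (N : ℕ → ℕ → ℕ → ℕ) :
    ∃ a : ℕ → ℕ, ∀ n, a n = N n (cfNum (interleaved a fun _ => 1) (2 * n))
      (cfDen (interleaved a fun _ => 1) (2 * n)) := by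
  -- The state is ((p_{2n-1}, q_{2n-1}), p_{2n}, q_{2n}), started with p_{-1} = 1 and q_{-1} = 0.
  let st : ℕ → (ℕ × ℕ) × ℕ × ℕ := fun n => Nat.rec ((1, 0), 0, 1) (fun n s =>
    ((2 * N n s.2.1 s.2.2 * s.2.1 + s.1.1, 2 * N n s.2.1 s.2.2 * s.2.2 + s.1.2),
      2 * N n s.2.1 s.2.2 * s.2.1 + s.1.1 + s.2.1,
      2 * N n s.2.1 s.2.2 * s.2.2 + s.1.2 + s.2.2)) n
  let a : ℕ → ℕ := fun n => N n (st n).2.1 (st n).2.2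
  have hev : ∀ n, interleaved a (fun _ => 1) (2 * n) = 2 * a n := fun n => by simp [interleaved]
  have hod : ∀ n, interleaved a (fun _ => 1) (2 * n + 1) = 1 := fun n => by simp [interleaved]
  have key : ∀ n, (st n).2.1 = cfNum (interleaved a fun _ => 1) (2 * n) ∧
      (st n).2.2 = cfDen (interleaved a fun _ => 1) (2 * n) ∧
      (st (n + 1)).1.1 = cfNum (interleaved a fun _ => 1) (2 * n + 1) ∧
      (st (n + 1)).1.2 = cfDen (interleaved a fun _ => 1) (2 * n + 1) := by
    intro n
    induction n with
    | zero =>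
      refine ⟨rfl, rfl, ?_, ?_⟩
      · simp [st, cfNum]
      · have := hev 0
        simp [st, cfDen, a] at this ⊢
        exact this.symm
    | succ n ih =>
      obtain ⟨h1, h2, h3, h4⟩ := ih
      have h5 : (st (n + 1)).2.1 = cfNum (interleaved a fun _ => 1) (2 * n + 2) := by
        rw [cfNum, hod, one_mul, ← h3, ← h1]
      have h6 : (st (n + 1)).2.2 = cfDen (interleaved a fun _ => 1) (2 * n + 2) := by
        rw [cfDen, hod, one_mul, ← h4, ← h2]
      refine ⟨h5, h6, ?_, ?_⟩
      · change _ = cfNum _ (2 * n + 1 + 2)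
        rw [cfNum, show 2 * n + 1 + 1 = 2 * (n + 1) by ring, hev]
        change _ = 2 * a (n + 1) * cfNum _ (2 * n + 2) + _
        rw [← h5, ← h3]
      · change _ = cfDen _ (2 * n + 1 + 2)
        rw [cfDen, show 2 * n + 1 + 1 = 2 * (n + 1) by ring, hev]
        change _ = 2 * a (n + 1) * cfDen _ (2 * n + 2) + _
        rw [← h6, ← h4]
  exact ⟨a, fun n => by rw [← (key n).1, ← (key n).2.1]⟩

theorem mul_cfDen_le (c : ℕ → ℕ) (n : ℕ) : c n * cfDen c n ≤ cfDen c (n + 1) := by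
  cases n with
  | zero => simp [cfDen]
  | succ n => exact Nat.le_add_right _ _

theorem cfDen_succ_le {c : ℕ → ℕ} (hc : ∀ n, 0 < c n) (n : ℕ) :
    cfDen c (n + 1) ≤ c n * cfDen c n + cfDen c n := by
  cases n with
  | zero => simp [cfDen]
  | succ n => exact Nat.add_le_add_left (cfDen_mono hc (Nat.le_succ n)) _

/-- The even partial quotients 2a_i keep q_{2n+1} even, like its second predecessor; adding it to
q_{2n} then preserves oddness. -/
theorem odd_cfDen_interleaved (a : ℕ → ℕ) (n : ℕ) :
    Odd (cfDen (interleaved a fun _ => 1) (2 * n)) ∧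
      Even (cfDen (interleaved a fun _ => 1) (2 * n + 1)) := by
  have hev : ∀ n, interleaved a (fun _ => 1) (2 * n) = 2 * a n := fun n => by simp [interleaved]
  have hod : ∀ n, interleaved a (fun _ => 1) (2 * n + 1) = 1 := fun n => by simp [interleaved]
  induction n with
  | zero => simp [cfDen, interleaved]
  | succ n ih =>
    constructor
    · change Odd (cfDen _ (2 * n + 2))
      rw [cfDen, hod, one_mul]
      exact ih.2.add_odd ih.1
    · change Even (cfDen _ (2 * n + 1 + 2))
      rw [cfDen, show 2 * n + 1 + 1 = 2 * (n + 1) by ring, hev, mul_assoc]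
      exact (even_two_mul _).add ih.2

/-- With Q = q_{2n} and d = q_{2n+2}, the choice of K makes d^{δ-1/2} at least (2^n Q)^{1+δ}, which
dominates both 2^n Q and 2^n Q^δ. The second bound uses d^{1-δ} = d^δ / d^{2δ-1} and d^δ ≤ (4aQ)^δ.
-/
theorem growth_bounds {δ Q a d : ℝ} {K n : ℕ} (hδ : 1 / 2 < δ) (hK : 1 + δ ≤ K * (δ - 1 / 2))
    (hQ : 1 ≤ Q) (ha : (2 ^ n * Q) ^ K ≤ a) (ha1 : 1 ≤ a) (had : a ≤ d) (hd : d ≤ 4 * a * Q) :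
    Q * d ^ (1 / 2 - δ) ≤ (1 / 2) ^ n ∧ d ^ (1 - δ) / a ^ δ ≤ 4 ^ δ * (1 / 2) ^ n := by
  set R : ℝ := 2 ^ n * Q with hR
  have h2n : (1 : ℝ) ≤ 2 ^ n := one_le_pow₀ (by norm_num)
  have hQR : Q ≤ R := le_mul_of_one_le_left (by linarith) h2n
  have hR1 : 1 ≤ R := hQ.trans hQR
  have hR0 : 0 < R := by linarith
  have hd0 : 0 < d := by linarith
  have ha0 : 0 < a := by linarith
  have hbig : R ^ (1 + δ) ≤ d ^ (δ - 1 / 2) := by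
    calc R ^ (1 + δ) ≤ R ^ (K * (δ - 1 / 2)) := Real.rpow_le_rpow_of_exponent_le hR1 hK
      _ = (R ^ K) ^ (δ - 1 / 2) := by rw [Real.rpow_mul hR0.le, Real.rpow_natCast]
      _ ≤ d ^ (δ - 1 / 2) :=
        Real.rpow_le_rpow (by positivity) (ha.trans had) (by linarith)
  have hRd : R ≤ d ^ (δ - 1 / 2) := by
    refine le_trans ?_ hbig
    rw [Real.rpow_add hR0, Real.rpow_one]
    exact le_mul_of_one_le_right hR0.le (Real.one_le_rpow hR1 (by linarith))
  have hinv : d ^ (1 / 2 - δ) = (d ^ (δ - 1 / 2))⁻¹ := by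
    rw [← Real.rpow_neg hd0.le, neg_sub]
  have hdp : 0 < d ^ (δ - 1 / 2) := by positivity
  constructor
  · rw [hinv, ← div_eq_mul_inv, div_le_iff₀ hdp, one_div, inv_pow, inv_mul_eq_div,
      le_div_iff₀ (by positivity)]
    linarith
  · have h1 : d ^ δ ≤ 4 ^ δ * Q ^ δ * a ^ δ := by
      rw [← Real.mul_rpow (by norm_num) (by linarith), ← Real.mul_rpow (by linarith) ha0.le]
      exact Real.rpow_le_rpow hd0.le (by linarith) (by linarith)
    have h2 : Q ^ δ * 2 ^ n ≤ d ^ (δ - 1 / 2) := by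
      refine le_trans ?_ hbig
      rw [Real.rpow_add hR0, Real.rpow_one, mul_comm]
      have h3 : Q ^ δ ≤ R ^ δ := Real.rpow_le_rpow (by linarith) hQR (by linarith)
      have h4 : (2 : ℝ) ^ n ≤ R := le_mul_of_one_le_right (by linarith) hQ
      exact mul_le_mul h4 h3 (by positivity) (by linarith)
    have h3 : 1 ≤ d ^ (δ - 1 / 2) := hR1.trans hRd
    have h4 : d ^ δ = d ^ (1 - δ) * (d ^ (δ - 1 / 2) * d ^ (δ - 1 / 2)) := by
      rw [← Real.rpow_add hd0, ← Real.rpow_add hd0]; congr 1; ring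
    set u := d ^ (δ - 1 / 2) with hu
    have hap : 0 < a ^ δ := by positivity
    have hw : 0 < d ^ (1 - δ) := by positivity
    have hQp : 0 < Q ^ δ := by positivity
    rw [div_le_iff₀ hap, one_div, inv_pow, mul_right_comm, ← div_eq_mul_inv,
      le_div_iff₀ (by positivity)]
    have h5 : d ^ (1 - δ) * (Q ^ δ * 2 ^ n) ≤ Q ^ δ * (4 ^ δ * a ^ δ) := by
      calc d ^ (1 - δ) * (Q ^ δ * 2 ^ n) ≤ d ^ (1 - δ) * (u * u) := by
            refine mul_le_mul_of_nonneg_left (h2.trans ?_) hw.le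
            exact le_mul_of_one_le_left (by linarith) h3
        _ = d ^ δ := h4.symm
        _ ≤ _ := h1.trans (le_of_eq (by ring))
    refine le_of_mul_le_mul_left ?_ hQp
    linarith

/-- The examples, with the recurrence sums of all points convergent, are not exhausted by any
sequence `s`. -/
theorem exists_isExample_notMem_range {δ : ℝ} (hδ : 1 / 2 < δ) (s : ℕ → ℝ) :
    ∃ α : ℝ, 0 ≤ α ∧ α < 1 ∧ IsExample δ α ∧
      (∀ x : UnitAddCircle, Summable fun n : balancedTimes α x => 1 / ((n : ℕ) : ℝ) ^ δ) ∧
      ∀ n, α ≠ s n := by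
  obtain ⟨K, hK⟩ := exists_nat_ge ((1 + δ) / (δ - 1 / 2))
  rw [div_le_iff₀ (by linarith)] at hK
  -- The power gives the growth, the ceiling separates α from `s n`, and 1 makes `a n` positive and
  -- the separation strict. If Q · s n = P the ceiling is 0, but then α ≠ s n since Qα ≠ P.
  obtain ⟨a, ha⟩ := exists_interleaved_eq fun n P Q =>
    (2 ^ n * Q) ^ K + ⌈1 / |Q * s n - P|⌉₊ + 1
  set c := interleaved a fun _ => 1 with hcdef
  have hev : ∀ n, c (2 * n) = 2 * a n := fun n => by simp [hcdef, interleaved]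
  have hod : ∀ n, c (2 * n + 1) = 1 := fun n => by simp [hcdef, interleaved]
  have ha0 : ∀ n, 0 < a n := fun n => by rw [ha]; omega
  have hc : ∀ n, 0 < c n := by
    intro n
    rcases Nat.even_or_odd' n with ⟨k, rfl | rfl⟩
    · rw [hev]; exact Nat.mul_pos two_pos (ha0 k)
    · rw [hod]; exact one_pos
  obtain ⟨α, hlim, hα⟩ := exists_contFrac_limit hc
  have hQ1 : ∀ n, (1 : ℝ) ≤ cfDen c n := fun n => by exact_mod_cast (cfDen_pos hc n).1
  have hlow : ∀ n, 2 * a n * cfDen c (2 * n) ≤ cfDen c (2 * n + 1) := fun n => by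
    have := mul_cfDen_le c (2 * n)
    rwa [hev] at this
  have hden : ∀ n, cfDen c (2 * n + 2) = cfDen c (2 * n + 1) + cfDen c (2 * n) := fun n => by
    rw [cfDen, hod, one_mul]
  have hup : ∀ n, cfDen c (2 * n + 2) ≤ 4 * a n * cfDen c (2 * n) := fun n => by
    have h1 := cfDen_succ_le hc (2 * n)
    rw [hev] at h1
    rw [hden]
    nlinarith [Nat.mul_le_mul_right (cfDen c (2 * n)) (ha0 n)]
  have ha1 : ∀ n, (1 : ℝ) ≤ a n := fun n => by exact_mod_cast ha0 n
  have ha2 : ∀ n, 2 * a n ≤ cfDen c (2 * n + 1) := fun n =>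
    (Nat.le_mul_of_pos_right _ (cfDen_pos hc (2 * n)).1).trans (hlow n)
  have hgrowth := fun n => growth_bounds (K := K) (n := n) hδ hK (hQ1 (2 * n)) (a := a n)
    (d := cfDen c (2 * n + 2))
    (by exact_mod_cast (show (2 ^ n * cfDen c (2 * n)) ^ K ≤ a n by rw [ha n]; omega)) (ha1 n)
    (by
      have h1 := ha2 n
      have h2 := hden n
      exact_mod_cast (by omega : a n ≤ cfDen c (2 * n + 2)))
    (by exact_mod_cast hup n)
  have hne := den_mul_sub_num_ne_zero hc hα
  refine ⟨α, ?_, ?_, ⟨a, fun _ => 1, ha0, fun _ => one_pos, hlim, ⟨1, fun _ => le_rfl⟩, ?_⟩,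
    summable_balancedTimes hδ.le hc hα (fun n => (odd_cfDen_interleaved a n).1) hod
      fun n => (hgrowth n).1, ?_⟩
  · refine ge_of_tendsto' hlim fun n => ?_
    rw [contFrac_convs]
    positivity
  · have h0 := hα 0
    have h1 : (2 : ℝ) ≤ cfDen c 1 := by
      have := ha2 0
      have := ha0 0
      exact_mod_cast (by omega : 2 ≤ cfDen c (2 * 0 + 1))
    simp only [cfDen, cfNum, Nat.cast_one, Nat.cast_zero, one_mul, sub_zero] at h0 h1
    have h2 : (1 : ℝ) / c 0 ≤ 1 / 2 := one_div_le_one_div_of_le two_pos h1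
    linarith [le_abs_self α]
  · refine Summable.of_nonneg_of_le (fun n => ?_) (fun n => ?_)
      ((summable_geometric_of_lt_one (by norm_num) (by norm_num : (1 / 2 : ℝ) < 1)).mul_left
        (4 ^ δ))
    · rw [contFrac_dens]
      positivity
    · rw [contFrac_dens]
      refine le_trans ?_ (hgrowth n).2
      have h1 : (a n : ℝ) ≤ ∑ i ∈ Finset.range (n + 1), (a i : ℝ) :=
        Finset.single_le_sum (f := fun i => (a i : ℝ)) (fun i _ => Nat.cast_nonneg _)
          (Finset.self_mem_range_succ n)
      have h2 : (0 : ℝ) < a n := by linarith [ha1 n]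
      exact div_le_div_of_nonneg_left (by positivity) (by positivity)
        (Real.rpow_le_rpow h2.le h1 (by linarith))
  -- If α = s n, then a_n > 1/|Qα - P| ≥ q_{2n+1} ≥ a_n.
  · rintro n rfl
    have h1 := hα (2 * n)
    have h2 : 0 < |(cfDen c (2 * n) : ℝ) * s n - cfNum c (2 * n)| := abs_pos.2 (hne (2 * n))
    have h3 : 1 / |(cfDen c (2 * n) : ℝ) * s n - cfNum c (2 * n)| < a n := by
      refine (Nat.le_ceil _).trans_lt ?_
      exact_mod_cast (show ⌈1 / |(cfDen c (2 * n) : ℝ) * s n - cfNum c (2 * n)|⌉₊ < a n by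
        rw [ha n]; omega)
    have h4 : (a n : ℝ) ≤ cfDen c (2 * n + 1) := by
      have := ha2 n
      exact_mod_cast (by omega : a n ≤ cfDen c (2 * n + 1))
    rw [div_lt_iff₀ h2] at h3
    rw [le_div_iff₀ (by linarith [hQ1 (2 * n + 1)])] at h1
    nlinarith

end BalancedTimes

theorem mainTheorem4 (δ : ℝ) (hδ : 1 / 2 < δ) :
    ¬ Set.Countable {α : ℝ | α ∈ Set.Ioo (0 : ℝ) 1 ∧ Irrational α ∧
      BalancedTimes.IsExample δ α ∧
      ∀ x : UnitAddCircle,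
        Summable fun n : BalancedTimes.balancedTimes α x => 1 / ((n : ℕ) : ℝ) ^ δ} := by
  intro hcount
  -- Listing the rationals too makes the avoiding α irrational, and makes the listed set nonempty.
  obtain ⟨s, hs⟩ := (hcount.union (Set.countable_range ((↑) : ℚ → ℝ))).exists_eq_range
    ⟨_, Or.inr ⟨0, rfl⟩⟩
  obtain ⟨α, hα0, hα1, hex, hsum, hne⟩ := BalancedTimes.exists_isExample_notMem_range hδ s
  have hnot : α ∉ Set.range s := fun ⟨n, hn⟩ => hne n hn.symm
  rw [← hs] at hnot
  have hirr : Irrational α := fun h => hnot (Or.inr h)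
  exact hnot (Or.inl ⟨⟨lt_of_le_of_ne hα0 hirr.ne_zero.symm, hα1⟩, hirr, hex, hsum⟩)
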